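/- A $2$-$(v,k,1)$-design is a geometry with $v$ points whose blocks are sets of $k$ points such that any two distinct points lie in exactly one block. Isomorphisms are bijections of the points that map the set of blocks onto the set of blocks. Let $q$ be a prime power, and let ${\rm PG}_1(3,q)$ be the geometry of points and lines of the projective space ${\rm PG}(3,q)$; it is a $2$-$(q^3+q^2+q+1,\,q+1,\,1)$-design. For every prime power $q$ there are two $2$-$(q^3+q^2+q+1,\,q+1,\,1)$-designs $\mathbf D_1$ and $\mathbf D_2$ such that $\mathbf D_1$, $\mathbf D_2$ and ${\rm PG}_1(3,q)$ are pairwise nonisomorphic and some point is fixed by every element of ${\rm Aut}\,\mathbf D_1$. For a plane $X$ of ${\rm PG}(3,q)$ and a permutation $\pi$ of the points of $X$, let $\mathbf D_\pi$ be the geometry with the points of ${\rm PG}(3,q)$ whose blocks are the lines not contained in $X$ and the sets $L^\pi$ for the lines $L\subset X$. If $q>2$, then for every plane $X$ and every transposition $\pi$ of two points of $X$, $\mathbf D_\pi$ is a $2$-$(q^3+q^2+q+1,\,q+1,\,1)$-design not isomorphic to ${\rm PG}_1(3,q)$, each automorphism of $\mathbf D_\pi$ fixes at least one point, and $\mathbf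 D_2$ above can be chosen to be $\mathbf D_\pi$ (with a suitable $\mathbf D_1$). -/

import Mathlib

/-- A point-block geometry on the point set `P`; every block is identified with its set of
points. -/
structure BlockGeometry (P : Type*) where
  blocks : Set (Set P)

namespace BlockGeometry

variable {P Q : Type*}

/-- `D` is a `2`-`(v, k, l)`-design: there are exactly `v` points, every block has exactly `k`
points, and any two distinct points lie in exactly `l` blocks. -/
structure IsTwoDesign (D : BlockGeometry P) (v k l : ℕ) : Prop where
  finite : Finite P
  card_points : Nat.card P = v
  card_block : ∀ B ∈ D.blocks, B.ncard = k
  card_joining : ∀ x y : P, x ≠ y → {B ∈ D.blocks | x ∈ B ∧ y ∈ B}.ncard = l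

/-- A bijection of the points that sends blocks to blocks and non-blocks to non-blocks. -/
def IsIsomorphism (D : BlockGeometry P) (D' : BlockGeometry Q) (e : P ≃ Q) : Prop :=
  ∀ B : Set P, e '' B ∈ D'.blocks ↔ B ∈ D.blocks

/-- Two geometries are isomorphic. -/
def Isomorphic (D : BlockGeometry P) (D' : BlockGeometry Q) : Prop :=
  ∃ e : P ≃ Q, D.IsIsomorphism D' e

/-- The full automorphism group, as a group of permutations of the points. -/
def autGroup (D : BlockGeometry P) : Subgroup (Equiv.Perm P) where
  carrier := {g | D.IsIsomorphism D g}
  one_mem' := fun B => by simp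
  mul_mem' := fun {g h} hg hh B => by
    have e : (⇑(g * h)) '' B = g '' (h '' B) := by
      rw [Set.image_image]; rfl
    rw [e]
    exact (hg _).trans (hh B)
  inv_mem' := fun {g} hg B => by
    have e : g '' ((⇑g⁻¹) '' B) = B := by
      rw [Set.image_image]; simp
    rw [← hg ((⇑g⁻¹) '' B), e]

end BlockGeometry

namespace ProjectiveDesign

variable (K : Type*) {V : Type*} [Field K] [AddCommGroup V] [Module K V]

/-- The set of points of the projective space `PG(V)` in the projective subspace defined by the
linear subspace `W` of `V`. -/
def points (W : Submodule K V) : Set (Projectivization K V) :=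
  {p | p.submodule ≤ W}

/-- `L` is a line of `PG(V)`. -/
def IsLine (L : Set (Projectivization K V)) : Prop :=
  ∃ W : Submodule K V, Module.finrank K W = 2 ∧ L = points K W

variable (V) in
/-- The point-line geometry `PG₁(V)`. -/
def PG : BlockGeometry (Projectivization K V) where
  blocks := {L | IsLine K L}

variable {K} in
/-- The image `L^π` of the part of `L` inside a set `X` of points under a permutation `π`
of `X`. -/
def permImage {X : Set (Projectivization K V)} (π : Equiv.Perm X)
    (L : Set (Projectivization K V)) : Set (Projectivization K V) :=
  {p | ∃ x : X, (x : Projectivization K V) ∈ L ∧ (π x : Projectivization K V) = p}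

variable {K} in
/-- The geometry `D_π` for a permutation `π` of the set `X` of points of the projective subspace
defined by `W`: its points are those of `PG(V)`, and its blocks are the lines not contained in
`X` together with the sets `L^π` for the lines `L ⊆ X`. -/
def twisted (W : Submodule K V) (π : Equiv.Perm (points K W)) :
    BlockGeometry (Projectivization K V) where
  blocks := {L | IsLine K L ∧ ¬ L ⊆ points K W} ∪
    {B | ∃ L, IsLine K L ∧ L ⊆ points K W ∧ B = permImage π L}

open scoped Classical in
/-- `π` is a transposition `(x₁, x₂)` with `x₁ ≠ x₂`. -/
def IsTransposition {α : Type*} (π : Equiv.Perm α) : Prop :=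
  π.IsSwap

end ProjectiveDesign

/-! Replacing the lines of a plane X by their images under a permutation σ of X again gives a
design: two points of X are joined inside X and all other pairs by an old line. The designs are told
apart by their Veblen points, an isomorphism invariant; in PG(3,q) every point is one. In a twisted
space the Veblen condition can be read off. A point of X is a Veblen point exactly when every
twisted block in X through it is an old line (`isVeblenPoint_twist_of_mem`,
`not_isVeblenPoint_twist_of_mem`). Once some line is changed, no point off X is a Veblen point
(`not_isVeblenPoint_twist_of_notMem`). Hence a cycle on a line of X minus a point z leaves only z,
which all automorphisms then fix. A 3-cycle on a triangle leaves no Veblen point. A transposition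
(x,y) leaves the q-1 further points of the line xy, so for q > 2 there are at least two. For the
transposition, an automorphism preserves the line xy, spanned by Veblen points, and also X, whose
complement consists of the points with a defect triangle. It therefore acts on the projective plane
X with an invariant line, and `exists_fixed_of_image_eq` gives a fixed point by a counting argument.
-/

namespace BlockGeometry

variable {P Q : Type*}

/-! ### Veblen conditions as isomorphism invariants -/

theorem IsIsomorphism.symm {D : BlockGeometry P} {D' : BlockGeometry Q} {e : P ≃ Q}
    (he : D.IsIsomorphism D' e) : D'.IsIsomorphism D e.symm := fun B => by
  rw [← he, Equiv.image_symm_image]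

/-- The Veblen condition for the pair of blocks `A`, `B` through `p`. -/
def Veblen (D : BlockGeometry P) (p : P) (A B : Set P) : Prop :=
  ∀ a₁ ∈ A, ∀ a₂ ∈ A, ∀ b₁ ∈ B, ∀ b₂ ∈ B, a₁ ≠ p → a₂ ≠ p → b₁ ≠ p → b₂ ≠ p →
    ∀ C ∈ D.blocks, ∀ C' ∈ D.blocks, a₁ ∈ C → b₁ ∈ C → a₂ ∈ C' → b₂ ∈ C' → (C ∩ C').Nonempty

/-- The Veblen condition holds for any two blocks through `p`. -/
def IsVeblenPoint (D : BlockGeometry P) (p : P) : Prop :=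
  ∀ A ∈ D.blocks, ∀ B ∈ D.blocks, p ∈ A → p ∈ B → A ≠ B → D.Veblen p A B

/-- There are three blocks through `p` no two of which satisfy the Veblen condition. -/
def HasDefectTriangle (D : BlockGeometry P) (p : P) : Prop :=
  ∃ A ∈ D.blocks, ∃ B ∈ D.blocks, ∃ C ∈ D.blocks, p ∈ A ∧ p ∈ B ∧ p ∈ C ∧
    A ≠ B ∧ A ≠ C ∧ B ≠ C ∧ ¬ D.Veblen p A B ∧ ¬ D.Veblen p A C ∧ ¬ D.Veblen p B C

theorem Veblen.symm {D : BlockGeometry P} {p : P} {A B : Set P} (h : D.Veblen p A B) :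
    D.Veblen p B A := fun b₁ hb₁ b₂ hb₂ a₁ ha₁ a₂ ha₂ nb₁ nb₂ na₁ na₂ C hC C' hC' h₁ h₂ h₃ h₄ =>
  h a₁ ha₁ a₂ ha₂ b₁ hb₁ b₂ hb₂ na₁ na₂ nb₁ nb₂ C hC C' hC' h₂ h₁ h₄ h₃

theorem Veblen.of_image {D : BlockGeometry P} {D' : BlockGeometry Q} {e : P ≃ Q}
    (he : D.IsIsomorphism D' e) {p : P} {A B : Set P} (h : D'.Veblen (e p) (e '' A) (e '' B)) :
    D.Veblen p A B := by
  intro a₁ ha₁ a₂ ha₂ b₁ hb₁ b₂ hb₂ na₁ na₂ nb₁ nb₂ C hC C' hC' h₁ h₂ h₃ h₄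
  have := h _ (Set.mem_image_of_mem e ha₁) _ (Set.mem_image_of_mem e ha₂)
    _ (Set.mem_image_of_mem e hb₁) _ (Set.mem_image_of_mem e hb₂)
    (e.injective.ne na₁) (e.injective.ne na₂) (e.injective.ne nb₁) (e.injective.ne nb₂)
    _ ((he C).2 hC) _ ((he C').2 hC') (Set.mem_image_of_mem e h₁) (Set.mem_image_of_mem e h₂)
    (Set.mem_image_of_mem e h₃) (Set.mem_image_of_mem e h₄)
  rw [← Set.image_inter e.injective] at this
  exact this.of_image

theorem Veblen.image {D : BlockGeometry P} {D' : BlockGeometry Q} {e : P ≃ Q}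
    (he : D.IsIsomorphism D' e) {p : P} {A B : Set P} (h : D.Veblen p A B) :
    D'.Veblen (e p) (e '' A) (e '' B) := by
  apply Veblen.of_image he.symm
  simpa only [Equiv.symm_apply_apply, Equiv.symm_image_image] using h

theorem IsVeblenPoint.of_apply {D : BlockGeometry P} {D' : BlockGeometry Q} {e : P ≃ Q}
    (he : D.IsIsomorphism D' e) {p : P} (h : D'.IsVeblenPoint (e p)) : D.IsVeblenPoint p :=
  fun A hA B hB pA pB hAB => Veblen.of_image he <|
    h _ ((he A).2 hA) _ ((he B).2 hB) (Set.mem_image_of_mem e pA) (Set.mem_image_of_mem e pB)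
      (e.injective.image_injective.ne hAB)

theorem IsVeblenPoint.apply {D : BlockGeometry P} {D' : BlockGeometry Q} {e : P ≃ Q}
    (he : D.IsIsomorphism D' e) {p : P} (h : D.IsVeblenPoint p) : D'.IsVeblenPoint (e p) :=
  IsVeblenPoint.of_apply he.symm (by simpa using h)

theorem HasDefectTriangle.apply {D : BlockGeometry P} {D' : BlockGeometry Q} {e : P ≃ Q}
    (he : D.IsIsomorphism D' e) {p : P} (h : D.HasDefectTriangle p) :
    D'.HasDefectTriangle (e p) := by
  obtain ⟨A, hA, B, hB, C, hC, pA, pB, pC, nAB, nAC, nBC, vAB, vAC, vBC⟩ := h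
  have inj := e.injective.image_injective
  exact ⟨_, (he A).2 hA, _, (he B).2 hB, _, (he C).2 hC, Set.mem_image_of_mem e pA,
    Set.mem_image_of_mem e pB, Set.mem_image_of_mem e pC, inj.ne nAB, inj.ne nAC, inj.ne nBC,
    fun h => vAB (h.of_image he), fun h => vAC (h.of_image he), fun h => vBC (h.of_image he)⟩

/-! ### Linear spaces with a distinguished plane, and their twists -/

/-- `G` is a finite linear space with `q + 1` points on each block in which the Veblen condition
holds everywhere, and the set `X` of points is a projective plane in `G`. -/
structure IsSpaceWithPlane (G : BlockGeometry P) (X : Set P) (q : ℕ) : Prop where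
  two_le : 2 ≤ q
  exists_block : ∀ x y, x ≠ y → ∃ L ∈ G.blocks, x ∈ L ∧ y ∈ L
  block_unique : ∀ {L M x y}, L ∈ G.blocks → M ∈ G.blocks → x ≠ y → x ∈ L → y ∈ L →
    x ∈ M → y ∈ M → L = M
  isVeblenPoint : ∀ p, G.IsVeblenPoint p
  ncard_block : ∀ L ∈ G.blocks, L.ncard = q + 1
  subset_plane : ∀ {L x y}, L ∈ G.blocks → x ≠ y → x ∈ L → y ∈ L → x ∈ X → y ∈ X → L ⊆ X
  meet : ∀ {L M}, L ∈ G.blocks → M ∈ G.blocks → L ⊆ X → M ⊆ X → (L ∩ M).Nonempty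
  exists_notMem_block : ∀ L ∈ G.blocks, ∃ w ∈ X, w ∉ L
  exists_notMem : ∃ w, w ∉ X
  exists_subset : ∃ L ∈ G.blocks, L ⊆ X

/-- The geometry obtained from `G` by replacing each block inside `X` by its image under `σ`. -/
def twist (G : BlockGeometry P) (X : Set P) (σ : Equiv.Perm P) : BlockGeometry P where
  blocks := {L | L ∈ G.blocks ∧ ¬ L ⊆ X} ∪ {B | ∃ L ∈ G.blocks, L ⊆ X ∧ B = σ '' L}

namespace IsSpaceWithPlane

set_option linter.unusedSectionVars false

variable [Finite P] {G : BlockGeometry P} {X : Set P} {q : ℕ}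

theorem exists_mem_ne_ne (h : G.IsSpaceWithPlane X q) {L : Set P} (hL : L ∈ G.blocks) (a b : P) :
    ∃ c ∈ L, c ≠ a ∧ c ≠ b := by
  have h2 : ({a, b} : Set P).ncard < L.ncard := by
    have : ({a, b} : Set P).ncard ≤ 2 := (Set.ncard_insert_le a {b}).trans (by simp)
    have := h.ncard_block L hL
    have := h.two_le
    omega
  obtain ⟨c, hc, hn⟩ := Set.exists_mem_notMem_of_ncard_lt_ncard h2
  exact ⟨c, hc, fun e => hn (by simp [e]), fun e => hn (by simp [e])⟩

theorem eq_of_mem_plane (h : G.IsSpaceWithPlane X q) {L : Set P} (hL : L ∈ G.blocks)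
    (hLX : ¬ L ⊆ X) {x y : P} (xL : x ∈ L) (yL : y ∈ L) (xX : x ∈ X) (yX : y ∈ X) : x = y := by
  by_contra hxy
  exact hLX (h.subset_plane hL hxy xL yL xX yX)

/-! ### The Veblen condition in a twisted space -/

section Twist

variable {σ : Equiv.Perm P}

theorem apply_mem_iff_symm (hσ : ∀ x, σ x ∈ X ↔ x ∈ X) (x : P) : σ.symm x ∈ X ↔ x ∈ X := by
  rw [← hσ, Equiv.apply_symm_apply]

theorem image_subset (hσ : ∀ x, σ x ∈ X ↔ x ∈ X) {L : Set P} (hL : L ⊆ X) : σ '' L ⊆ X := by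
  rintro _ ⟨x, hx, rfl⟩
  exact (hσ x).2 (hL hx)

theorem mem_twist_of_not_subset (hσ : ∀ x, σ x ∈ X ↔ x ∈ X) {L : Set P} (hL : ¬ L ⊆ X) :
    L ∈ (G.twist X σ).blocks ↔ L ∈ G.blocks := by
  constructor
  · rintro (h | ⟨M, -, hM, rfl⟩)
    · exact h.1
    · exact absurd (image_subset hσ hM) hL
  · exact fun h => Or.inl ⟨h, hL⟩

theorem mem_twist_of_subset {L : Set P} (hL : L ⊆ X) :
    L ∈ (G.twist X σ).blocks ↔ ∃ M ∈ G.blocks, M ⊆ X ∧ L = σ '' M := by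
  constructor
  · rintro (h | h)
    · exact absurd hL h.2
    · exact h
  · exact fun h => Or.inr h

theorem ncard_twist (h : G.IsSpaceWithPlane X q) {B : Set P} (hB : B ∈ (G.twist X σ).blocks) :
    B.ncard = q + 1 := by
  rcases hB with hB | ⟨M, hM, -, rfl⟩
  · exact h.ncard_block _ hB.1
  · rw [Set.ncard_image_of_injective _ σ.injective, h.ncard_block _ hM]

theorem twist_exists_block (h : G.IsSpaceWithPlane X q) (hσ : ∀ x, σ x ∈ X ↔ x ∈ X) {x y : P}
    (hxy : x ≠ y) : ∃ B ∈ (G.twist X σ).blocks, x ∈ B ∧ y ∈ B := by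
  by_cases hX : x ∈ X ∧ y ∈ X
  · have hs : σ.symm x ≠ σ.symm y := σ.symm.injective.ne hxy
    obtain ⟨L, hL, xL, yL⟩ := h.exists_block _ _ hs
    refine ⟨σ '' L, Or.inr ⟨L, hL, h.subset_plane hL hs xL yL
      ((apply_mem_iff_symm hσ x).2 hX.1) ((apply_mem_iff_symm hσ y).2 hX.2), rfl⟩,
      ⟨_, xL, by simp⟩, ⟨_, yL, by simp⟩⟩
  · obtain ⟨L, hL, xL, yL⟩ := h.exists_block _ _ hxy
    exact ⟨L, Or.inl ⟨hL, fun hs => hX ⟨hs xL, hs yL⟩⟩, xL, yL⟩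

theorem twist_subset_plane (h : G.IsSpaceWithPlane X q) (hσ : ∀ x, σ x ∈ X ↔ x ∈ X)
    {B : Set P} {x y : P} (hB : B ∈ (G.twist X σ).blocks) (hxy : x ≠ y) (xB : x ∈ B) (yB : y ∈ B)
    (xX : x ∈ X) (yX : y ∈ X) : B ⊆ X := by
  by_contra hn
  exact hn (h.subset_plane ((mem_twist_of_not_subset hσ hn).1 hB) hxy xB yB xX yX)

theorem twist_block_unique (h : G.IsSpaceWithPlane X q) (hσ : ∀ x, σ x ∈ X ↔ x ∈ X)
    {B C : Set P} {x y : P} (hB : B ∈ (G.twist X σ).blocks) (hC : C ∈ (G.twist X σ).blocks)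
    (hxy : x ≠ y) (xB : x ∈ B) (yB : y ∈ B) (xC : x ∈ C) (yC : y ∈ C) : B = C := by
  by_cases hX : x ∈ X ∧ y ∈ X
  · obtain ⟨L, hL, -, rfl⟩ :=
      (mem_twist_of_subset (h.twist_subset_plane hσ hB hxy xB yB hX.1 hX.2)).1 hB
    obtain ⟨M, hM, -, rfl⟩ :=
      (mem_twist_of_subset (h.twist_subset_plane hσ hC hxy xC yC hX.1 hX.2)).1 hC
    rw [Equiv.image_eq_preimage_symm] at xB yB xC yC
    rw [h.block_unique hL hM (σ.symm.injective.ne hxy) xB yB xC yC]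
  · have nB : ¬ B ⊆ X := fun hs => hX ⟨hs xB, hs yB⟩
    have nC : ¬ C ⊆ X := fun hs => hX ⟨hs xC, hs yC⟩
    exact h.block_unique ((mem_twist_of_not_subset hσ nB).1 hB)
      ((mem_twist_of_not_subset hσ nC).1 hC) hxy xB yB xC yC

theorem twist_isTwoDesign (h : G.IsSpaceWithPlane X q) (hσ : ∀ x, σ x ∈ X ↔ x ∈ X) :
    (G.twist X σ).IsTwoDesign (Nat.card P) (q + 1) 1 where
  finite := inferInstance
  card_points := rfl
  card_block _ hB := h.ncard_twist hB
  card_joining x y hxy := by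
    obtain ⟨B, hB, xB, yB⟩ := h.twist_exists_block hσ hxy
    rw [Set.ncard_eq_one]
    refine ⟨B, Set.eq_singleton_iff_unique_mem.2 ⟨⟨hB, xB, yB⟩, ?_⟩⟩
    rintro C ⟨hC, xC, yC⟩
    exact h.twist_block_unique hσ hC hB hxy xC yC xB yB

theorem twist_meet (h : G.IsSpaceWithPlane X q) {B C : Set P} (hB : B ∈ (G.twist X σ).blocks)
    (hC : C ∈ (G.twist X σ).blocks) (hBX : B ⊆ X) (hCX : C ⊆ X) : (B ∩ C).Nonempty := by
  obtain ⟨L, hL, hLX, rfl⟩ := (mem_twist_of_subset hBX).1 hB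
  obtain ⟨M, hM, hMX, rfl⟩ := (mem_twist_of_subset hCX).1 hC
  rw [← Set.image_inter σ.injective]
  exact (h.meet hL hM hLX hMX).image σ

/-- All joining blocks stay in X, which is still a projective plane after twisting. -/
theorem veblen_of_subset (h : G.IsSpaceWithPlane X q) (hσ : ∀ x, σ x ∈ X ↔ x ∈ X) {p : P}
    {A B : Set P} (hA : A ∈ (G.twist X σ).blocks) (hB : B ∈ (G.twist X σ).blocks)
    (hAB : A ≠ B) (pA : p ∈ A) (pB : p ∈ B) (hAX : A ⊆ X) (hBX : B ⊆ X) :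
    (G.twist X σ).Veblen p A B := by
  have key : ∀ a ∈ A, ∀ b ∈ B, a ≠ p → ∀ C ∈ (G.twist X σ).blocks, a ∈ C → b ∈ C → C ⊆ X := by
    intro a aA b bB ap C hC aC bC
    refine h.twist_subset_plane hσ hC ?_ aC bC (hAX aA) (hBX bB)
    rintro rfl
    exact hAB (h.twist_block_unique hσ hA hB ap aA pA bB pB)
  intro a₁ ha₁ a₂ ha₂ b₁ hb₁ b₂ hb₂ na₁ na₂ nb₁ nb₂ C hC C' hC' h₁ h₂ h₃ h₄
  exact h.twist_meet hC hC' (key _ ha₁ _ hb₁ na₁ C hC h₁ h₂) (key _ ha₂ _ hb₂ na₂ C' hC' h₃ h₄)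

/-- B meets X only in p, so every joining block leaves X and is an old line; the condition is
inherited from `G`. -/
theorem veblen_of_mem_block (h : G.IsSpaceWithPlane X q) (hσ : ∀ x, σ x ∈ X ↔ x ∈ X) {p : P}
    {A B : Set P} (pX : p ∈ X) (hA : A ∈ G.blocks) (hB : B ∈ G.blocks) (hAB : A ≠ B) (pA : p ∈ A)
    (pB : p ∈ B) (hBX : ¬ B ⊆ X) : (G.twist X σ).Veblen p A B := by
  have key : ∀ b ∈ B, b ≠ p → ∀ C ∈ (G.twist X σ).blocks, b ∈ C → C ∈ G.blocks := by
    intro b bB bp C hC bC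
    have hCX : ¬ C ⊆ X := fun hs => bp (h.eq_of_mem_plane hB hBX bB pB (hs bC) pX)
    exact (mem_twist_of_not_subset hσ hCX).1 hC
  intro a₁ ha₁ a₂ ha₂ b₁ hb₁ b₂ hb₂ na₁ na₂ nb₁ nb₂ C hC C' hC' h₁ h₂ h₃ h₄
  exact h.isVeblenPoint p A hA B hB pA pB hAB a₁ ha₁ a₂ ha₂ b₁ hb₁ b₂ hb₂ na₁ na₂ nb₁ nb₂
    C (key _ hb₁ nb₁ C hC h₂) C' (key _ hb₂ nb₂ C' hC' h₄) h₁ h₂ h₃ h₄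

theorem not_veblen_of_notMem_blocks (h : G.IsSpaceWithPlane X q) (hσ : ∀ x, σ x ∈ X ↔ x ∈ X)
    {p : P} {A B : Set P} (hA : A ∈ (G.twist X σ).blocks) (hA' : A ∉ G.blocks)
    (hB : B ∈ G.blocks) (pA : p ∈ A) (pB : p ∈ B) (hAX : A ⊆ X) (hBX : ¬ B ⊆ X) :
    ¬ (G.twist X σ).Veblen p A B := by
  intro hv
  have hcard : 1 < A.ncard := by
    have := h.ncard_twist hA
    have := h.two_le
    omega
  obtain ⟨a₁, ha₁, na₁⟩ := Set.exists_ne_of_one_lt_ncard hcard p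
  obtain ⟨L, hL, a₁L, pL⟩ := h.exists_block _ _ na₁
  -- All blocks have q + 1 points, so inclusion would make A the old line L.
  have : ¬ A ⊆ L := fun hs => by
    have e := Set.eq_of_subset_of_ncard_le hs (by rw [h.ncard_twist hA, h.ncard_block L hL])
    exact hA' (e ▸ hL)
  obtain ⟨a₂, ha₂, na₂⟩ := Set.not_subset.1 this
  have a₂p : a₂ ≠ p := fun e => na₂ (e ▸ pL)
  have a₁₂ : a₁ ≠ a₂ := fun e => na₂ (e ▸ a₁L)
  obtain ⟨b₁, hb₁, nb₁, -⟩ := h.exists_mem_ne_ne hB p p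
  obtain ⟨b₂, hb₂, nb₂, nb₁₂⟩ := h.exists_mem_ne_ne hB p b₁
  have hbX : ∀ b ∈ B, b ≠ p → b ∉ X :=
    fun b hb nb bX => nb (h.eq_of_mem_plane hB hBX hb pB bX (hAX pA))
  have b₁X := hbX b₁ hb₁ nb₁
  have b₂X := hbX b₂ hb₂ nb₂
  obtain ⟨C, hC, a₁C, b₁C⟩ := h.exists_block a₁ b₁ (fun e => b₁X (e ▸ hAX ha₁))
  obtain ⟨C', hC', a₂C', b₂C'⟩ := h.exists_block a₂ b₂ (fun e => b₂X (e ▸ hAX ha₂))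
  have hCX : ¬ C ⊆ X := fun hs => b₁X (hs b₁C)
  have hCX' : ¬ C' ⊆ X := fun hs => b₂X (hs b₂C')
  obtain ⟨c, cC, cC'⟩ := hv a₁ ha₁ a₂ ha₂ b₁ hb₁ b₂ hb₂ na₁ a₂p nb₁ nb₂ C
    ((mem_twist_of_not_subset hσ hCX).2 hC) C' ((mem_twist_of_not_subset hσ hCX').2 hC')
    a₁C b₁C a₂C' b₂C'
  have na₁C' : a₁ ∉ C' := fun hm => a₁₂ (h.eq_of_mem_plane hC' hCX' hm a₂C' (hAX ha₁) (hAX ha₂))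
  have na₂C : a₂ ∉ C := fun hm => a₁₂ (h.eq_of_mem_plane hC hCX a₁C hm (hAX ha₁) (hAX ha₂))
  have cb₁ : b₁ ≠ c := by
    rintro rfl
    have e := h.block_unique hC' hB nb₁₂ b₂C' cC' hb₂ hb₁
    exact a₂p (h.eq_of_mem_plane hB hBX (e ▸ a₂C') pB (hAX ha₂) (hAX pA))
  have cb₂ : b₂ ≠ c := by
    rintro rfl
    have e := h.block_unique hC hB nb₁₂ cC b₁C hb₂ hb₁
    exact na₁ (h.eq_of_mem_plane hB hBX (e ▸ a₁C) pB (hAX ha₁) (hAX pA))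
  obtain ⟨M, hM, a₁M, a₂M⟩ := h.exists_block _ _ a₁₂
  -- The Veblen condition of `G` at c makes the line through a₁ and a₂ meet B. It does so inside X,
  -- hence in p, which puts a₂ on the line L through p and a₁.
  obtain ⟨d, dM, dB⟩ := h.isVeblenPoint c C hC C' hC' cC cC' (fun e => na₁C' (e ▸ a₁C))
    a₁ a₁C b₁ b₁C a₂ a₂C' b₂ b₂C' (fun e => na₁C' (e ▸ cC')) cb₁ (fun e => na₂C (e ▸ cC)) cb₂
    M hM B hB a₁M a₂M hb₁ hb₂
  have hMX := h.subset_plane hM a₁₂ a₁M a₂M (hAX ha₁) (hAX ha₂)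
  have e := h.eq_of_mem_plane hB hBX dB pB (hMX dM) (hAX pA)
  subst e
  exact na₂ (h.block_unique hM hL na₁ a₁M dM a₁L pL ▸ a₂M)

/-- The twisted block C through a and b misses some z on L. A line joining z to a third point of A
meets B by the Veblen condition of `G`, but meets X only in z, so it misses C. -/
theorem not_veblen_of_notMem_plane (h : G.IsSpaceWithPlane X q) (hσ : ∀ x, σ x ∈ X ↔ x ∈ X)
    {p a b : P} {A B L : Set P} (hA : A ∈ G.blocks) (hB : B ∈ G.blocks) (hL : L ∈ G.blocks)
    (pX : p ∉ X) (pA : p ∈ A) (pB : p ∈ B) (aA : a ∈ A) (bB : b ∈ B) (hab : a ≠ b) (aL : a ∈ L)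
    (bL : b ∈ L) (hLX : L ⊆ X) (hL' : L ∉ (G.twist X σ).blocks) :
    ¬ (G.twist X σ).Veblen p A B := by
  intro hv
  have hAX : ¬ A ⊆ X := fun hs => pX (hs pA)
  have hBX : ¬ B ⊆ X := fun hs => pX (hs pB)
  have ap : a ≠ p := fun e => pX (e ▸ hLX aL)
  have bp : b ≠ p := fun e => pX (e ▸ hLX bL)
  obtain ⟨C, hC, aC, bC⟩ := h.twist_exists_block hσ hab
  have hCX := h.twist_subset_plane hσ hC hab aC bC (hLX aL) (hLX bL)
  have : ¬ L ⊆ C := fun hs => by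
    have e := Set.eq_of_subset_of_ncard_le hs (by rw [h.ncard_twist hC, h.ncard_block L hL])
    exact hL' (e ▸ hC)
  obtain ⟨z, zL, zC⟩ := Set.not_subset.1 this
  have za : z ≠ a := fun e => zC (e ▸ aC)
  obtain ⟨a₂, ha₂, a₂p, a₂a⟩ := h.exists_mem_ne_ne hA p a
  have a₂X : a₂ ∉ X := fun hm => a₂a (h.eq_of_mem_plane hA hAX ha₂ aA hm (hLX aL))
  obtain ⟨C', hC', zC', a₂C'⟩ := h.exists_block z a₂ (fun e => a₂X (e ▸ hLX zL))
  have hCX' : ¬ C' ⊆ X := fun hs => a₂X (hs a₂C')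
  obtain ⟨b₂, b₂C', b₂B⟩ := h.isVeblenPoint a L hL A hA aL aA (fun e => hAX (e ▸ hLX))
    z zL b bL a₂ ha₂ p pA za hab.symm a₂a ap.symm C' hC' B hB zC' a₂C' bB pB
  have b₂p : b₂ ≠ p := by
    rintro rfl
    have e := h.block_unique hC' hA a₂p a₂C' b₂C' ha₂ pA
    exact za (h.eq_of_mem_plane hA hAX (e ▸ zC') aA (hLX zL) (hLX aL))
  obtain ⟨c, cC, cC'⟩ := hv a aA a₂ ha₂ b bB b₂ b₂B ap a₂p bp b₂p C hC C'
    ((mem_twist_of_not_subset hσ hCX').2 hC') aC bC a₂C' b₂C'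
  exact zC (h.eq_of_mem_plane hC' hCX' cC' zC' (hCX cC) (hLX zL) ▸ cC)

theorem exists_block_not_subset (h : G.IsSpaceWithPlane X q) {p : P} (pX : p ∈ X) :
    ∃ B ∈ G.blocks, p ∈ B ∧ ¬ B ⊆ X := by
  obtain ⟨w, hw⟩ := h.exists_notMem
  obtain ⟨B, hB, pB, wB⟩ := h.exists_block p w (fun e => hw (e ▸ pX))
  exact ⟨B, hB, pB, fun hs => hw (hs wB)⟩

theorem isVeblenPoint_twist_of_mem (h : G.IsSpaceWithPlane X q) (hσ : ∀ x, σ x ∈ X ↔ x ∈ X)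
    {p : P} (pX : p ∈ X) (hp : ∀ L ∈ G.blocks, L ⊆ X → p ∈ σ '' L → σ '' L ∈ G.blocks) :
    (G.twist X σ).IsVeblenPoint p := by
  have hp' : ∀ A ∈ (G.twist X σ).blocks, p ∈ A → A ∈ G.blocks := by
    rintro A (hA | ⟨L, hL, hLX, rfl⟩) pA
    · exact hA.1
    · exact hp L hL hLX pA
  intro A hA B hB pA pB hAB
  by_cases hAX : A ⊆ X
  · by_cases hBX : B ⊆ X
    · exact h.veblen_of_subset hσ hA hB hAB pA pB hAX hBX
    · exact h.veblen_of_mem_block hσ pX (hp' A hA pA) (hp' B hB pB) hAB pA pB hBX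
  · exact (h.veblen_of_mem_block hσ pX (hp' B hB pB) (hp' A hA pA) hAB.symm pB pA hAX).symm

theorem not_isVeblenPoint_twist_of_mem (h : G.IsSpaceWithPlane X q) (hσ : ∀ x, σ x ∈ X ↔ x ∈ X)
    {p : P} {L : Set P} (hL : L ∈ G.blocks) (hLX : L ⊆ X) (pL : p ∈ σ '' L)
    (hn : σ '' L ∉ G.blocks) : ¬ (G.twist X σ).IsVeblenPoint p := by
  have hs := image_subset hσ hLX
  obtain ⟨B, hB, pB, hBX⟩ := h.exists_block_not_subset (hs pL)
  have hA : σ '' L ∈ (G.twist X σ).blocks := Or.inr ⟨L, hL, hLX, rfl⟩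
  exact fun hv => h.not_veblen_of_notMem_blocks hσ hA hn hB pL pB hs hBX
    (hv _ hA _ (Or.inl ⟨hB, hBX⟩) pL pB (fun e => hBX (e ▸ hs)))

/-- Blocks of the twist are determined by two points, so a new block displaces the old line through
any two of its points. -/
theorem exists_block_notMem_twist (h : G.IsSpaceWithPlane X q) (hσ : ∀ x, σ x ∈ X ↔ x ∈ X)
    {L : Set P} (hL : L ∈ G.blocks) (hLX : L ⊆ X) (hn : σ '' L ∉ G.blocks) {a b : P}
    (hab : a ≠ b) (ha : a ∈ σ '' L) (hb : b ∈ σ '' L) {M : Set P} (hM : M ∈ G.blocks)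
    (aM : a ∈ M) (bM : b ∈ M) : M ∉ (G.twist X σ).blocks := fun hM' =>
  hn (h.twist_block_unique hσ hM' (Or.inr ⟨L, hL, hLX, rfl⟩) hab aM bM ha hb ▸ hM)

theorem not_isVeblenPoint_twist_of_notMem (h : G.IsSpaceWithPlane X q)
    (hσ : ∀ x, σ x ∈ X ↔ x ∈ X) {p : P} (pX : p ∉ X) {L : Set P} (hL : L ∈ G.blocks)
    (hLX : L ⊆ X) (hn : σ '' L ∉ G.blocks) : ¬ (G.twist X σ).IsVeblenPoint p := by
  intro hv
  obtain ⟨a', ha', -, -⟩ := h.exists_mem_ne_ne hL p p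
  obtain ⟨b', hb', hab', -⟩ := h.exists_mem_ne_ne hL a' a'
  have hab : σ a' ≠ σ b' := σ.injective.ne hab'.symm
  have aX : σ a' ∈ X := (hσ a').2 (hLX ha')
  have bX : σ b' ∈ X := (hσ b').2 (hLX hb')
  obtain ⟨M, hM, aM, bM⟩ := h.exists_block _ _ hab
  have hM' := h.exists_block_notMem_twist hσ hL hLX hn hab (Set.mem_image_of_mem σ ha')
    (Set.mem_image_of_mem σ hb') hM aM bM
  obtain ⟨A, hA, pA, aA⟩ := h.exists_block p (σ a') (fun e => pX (e ▸ aX))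
  obtain ⟨B, hB, pB, bB⟩ := h.exists_block p (σ b') (fun e => pX (e ▸ bX))
  have hAX : ¬ A ⊆ X := fun hs => pX (hs pA)
  have hBX : ¬ B ⊆ X := fun hs => pX (hs pB)
  refine h.not_veblen_of_notMem_plane hσ hA hB hM pX pA pB aA bB hab aM bM
    (h.subset_plane hM hab aM bM aX bX) hM' (hv A (Or.inl ⟨hA, hAX⟩) B (Or.inl ⟨hB, hBX⟩) pA pB ?_)
  rintro rfl
  exact hab (h.eq_of_mem_plane hA hAX aA bB aX bX)

theorem not_hasDefectTriangle_of_mem (h : G.IsSpaceWithPlane X q) (hσ : ∀ x, σ x ∈ X ↔ x ∈ X)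
    {p : P} (pX : p ∈ X) : ¬ (G.twist X σ).HasDefectTriangle p := by
  -- A failing pair has exactly one member inside X, and among three blocks this cannot hold for
  -- every pair.
  have key : ∀ A ∈ (G.twist X σ).blocks, ∀ B ∈ (G.twist X σ).blocks, p ∈ A → p ∈ B → A ≠ B →
      ¬ (G.twist X σ).Veblen p A B → (A ⊆ X ↔ ¬ B ⊆ X) := by
    intro A hA B hB pA pB hAB hv
    by_cases hAX : A ⊆ X <;> by_cases hBX : B ⊆ X
    · exact absurd (h.veblen_of_subset hσ hA hB hAB pA pB hAX hBX) hv
    · simp [hAX, hBX]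
    · simp [hAX, hBX]
    · exact absurd (h.veblen_of_mem_block hσ pX ((mem_twist_of_not_subset hσ hAX).1 hA)
        ((mem_twist_of_not_subset hσ hBX).1 hB) hAB pA pB hBX) hv
  rintro ⟨A, hA, B, hB, C, hC, pA, pB, pC, nAB, nAC, nBC, vAB, vAC, vBC⟩
  have h₁ := key A hA B hB pA pB nAB vAB
  have h₂ := key A hA C hC pA pC nAC vAC
  have h₃ := key B hB C hC pB pC nBC vBC
  tauto

theorem hasDefectTriangle_of_notMem (h : G.IsSpaceWithPlane X q) (hσ : ∀ x, σ x ∈ X ↔ x ∈ X)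
    {p a b c : P} (pX : p ∉ X) (aX : a ∈ X) (bX : b ∈ X) (cX : c ∈ X) (hab : a ≠ b) (hac : a ≠ c)
    (hbc : b ≠ c)
    (habn : ∀ M ∈ G.blocks, a ∈ M → b ∈ M → M ∉ (G.twist X σ).blocks)
    (hacn : ∀ M ∈ G.blocks, a ∈ M → c ∈ M → M ∉ (G.twist X σ).blocks)
    (hbcn : ∀ M ∈ G.blocks, b ∈ M → c ∈ M → M ∉ (G.twist X σ).blocks) :
    (G.twist X σ).HasDefectTriangle p := by
  obtain ⟨A, hA, pA, aA⟩ := h.exists_block p a (fun e => pX (e ▸ aX))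
  obtain ⟨B, hB, pB, bB⟩ := h.exists_block p b (fun e => pX (e ▸ bX))
  obtain ⟨C, hC, pC, cC⟩ := h.exists_block p c (fun e => pX (e ▸ cX))
  have hne : ∀ {A B : Set P} {a b : P}, A ∈ G.blocks → p ∈ A → a ∈ A → b ∈ B → a ∈ X → b ∈ X →
      a ≠ b → A ≠ B := by
    rintro A _ a b hA pA aA bB aX bX hab rfl
    exact hab (h.eq_of_mem_plane hA (fun hs => pX (hs pA)) aA bB aX bX)
  have hnv : ∀ {A B : Set P} {a b : P}, A ∈ G.blocks → B ∈ G.blocks → p ∈ A → p ∈ B → a ∈ A →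
      b ∈ B → a ∈ X → b ∈ X → a ≠ b →
      (∀ M ∈ G.blocks, a ∈ M → b ∈ M → M ∉ (G.twist X σ).blocks) →
      ¬ (G.twist X σ).Veblen p A B := by
    intro A B a b hA hB pA pB aA bB aX bX hab hn
    obtain ⟨M, hM, aM, bM⟩ := h.exists_block _ _ hab
    exact h.not_veblen_of_notMem_plane hσ hA hB hM pX pA pB aA bB hab aM bM
      (h.subset_plane hM hab aM bM aX bX) (hn M hM aM bM)
  exact ⟨A, Or.inl ⟨hA, fun hs => pX (hs pA)⟩, B, Or.inl ⟨hB, fun hs => pX (hs pB)⟩,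
    C, Or.inl ⟨hC, fun hs => pX (hs pC)⟩, pA, pB, pC, hne hA pA aA bB aX bX hab,
    hne hA pA aA cC aX cX hac, hne hB pB bB cC bX cX hbc,
    hnv hA hB pA pB aA bB aX bX hab habn, hnv hA hC pA pC aA cC aX cX hac hacn,
    hnv hB hC pB pC bB cC bX cX hbc hbcn⟩

end Twist

/-! ### Permutations leaving one Veblen point or none -/

variable {σ : Equiv.Perm P}

/-- A line has at least three points, so two points of M are fixed and the image could only be M
itself. -/
theorem image_notMem_blocks_of_fix (h : G.IsSpaceWithPlane X q) {M : Set P} (hM : M ∈ G.blocks)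
    {t : P} (tM : t ∈ M) (hfix : ∀ m ∈ M, m ≠ t → σ m = m) (ht : σ t ∉ M) :
    σ '' M ∉ G.blocks := by
  intro hn
  obtain ⟨u, hu, hut, -⟩ := h.exists_mem_ne_ne hM t t
  obtain ⟨v, hv, hvt, hvu⟩ := h.exists_mem_ne_ne hM t u
  have e := h.block_unique hn hM hvu ⟨v, hv, hfix v hv hvt⟩ ⟨u, hu, hfix u hu hut⟩ hv hu
  exact ht (e ▸ Set.mem_image_of_mem σ tM)

/-- The image contains b and a third, fixed point of M, so it could only be M; but it also contains
c. -/
theorem image_notMem_blocks_of_pair (h : G.IsSpaceWithPlane X q) {M : Set P} (hM : M ∈ G.blocks)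
    {a b c : P} (aM : a ∈ M) (bM : b ∈ M) (cM : c ∉ M) (ha : σ a = b) (hb : σ b = c)
    (hfix : ∀ m ∈ M, m ≠ a → m ≠ b → σ m = m) : σ '' M ∉ G.blocks := by
  intro hn
  obtain ⟨u, hu, hua, hub⟩ := h.exists_mem_ne_ne hM a b
  have e := h.block_unique hn hM hub ⟨u, hu, hfix u hu hua hub⟩ ⟨a, aM, ha⟩ hu bM
  exact cM (e ▸ ⟨b, bM, hb⟩)

/-- Deranging all points but one of a line of `X` leaves exactly one Veblen point. -/
theorem exists_twist_unique_isVeblenPoint (h : G.IsSpaceWithPlane X q) :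
    ∃ σ : Equiv.Perm P, (∀ x, σ x ∈ X ↔ x ∈ X) ∧
      ∃ z, ∀ p, (G.twist X σ).IsVeblenPoint p ↔ p = z := by
  classical
  obtain ⟨L, hL, hLX⟩ := h.exists_subset
  obtain ⟨w, wX, wL⟩ := h.exists_notMem_block L hL
  obtain ⟨z, zL, -, -⟩ := h.exists_mem_ne_ne hL w w
  have hfin : (L \ {z}).Finite := Set.toFinite _
  -- A single cycle on the q ≥ 2 points of L other than z moves each of them and nothing else.
  obtain ⟨σ, hσ, hsupp⟩ := hfin.countable.exists_cycleOn
  have hnt : (L \ {z}).Nontrivial := by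
    obtain ⟨u, hu, huz, -⟩ := h.exists_mem_ne_ne hL z z
    obtain ⟨v, hv, hvz, hvu⟩ := h.exists_mem_ne_ne hL z u
    exact ⟨u, ⟨hu, huz⟩, v, ⟨hv, hvz⟩, hvu.symm⟩
  have hmov : ∀ t ∈ L, t ≠ z → σ t ∈ L ∧ σ t ≠ z ∧ σ t ≠ t := fun t ht htz => by
    have := hσ.1.mapsTo ⟨ht, htz⟩
    exact ⟨this.1, this.2, hσ.apply_ne hnt ⟨ht, htz⟩⟩
  have hfix : ∀ t, ¬ (t ∈ L ∧ t ≠ z) → σ t = t := fun t ht => by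
    by_contra hn
    exact ht (hsupp hn)
  have hX : ∀ x, σ x ∈ X ↔ x ∈ X := fun x => by
    by_cases hx : x ∈ L ∧ x ≠ z
    · exact iff_of_true (hLX (hmov x hx.1 hx.2).1) (hLX hx.1)
    · rw [hfix x hx]
  have hz : σ z = z := hfix z (fun hn => hn.2 rfl)
  have hnon : ∀ M ∈ G.blocks, M ≠ L → ∀ t ∈ M, t ∈ L → t ≠ z → σ '' M ∉ G.blocks := by
    intro M hM hML t tM tL tz
    have huniq : ∀ m ∈ M, m ∈ L → m = t := fun m mM mL => by
      by_contra hn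
      exact hML (h.block_unique hM hL hn mM tM mL tL)
    obtain ⟨h₁, -, h₃⟩ := hmov t tL tz
    exact h.image_notMem_blocks_of_fix hM tM
      (fun m mM hm => hfix m fun hn => hm (huniq m mM hn.1)) (fun hm => h₃ (huniq _ hm h₁))
  -- For p on L, the line from the preimage of p to w is changed and its image passes through p. For
  -- p off L, p is fixed and any line from p to a moved point of L serves.
  have hX_notV : ∀ p ∈ X, p ≠ z → ∃ M ∈ G.blocks, M ⊆ X ∧ p ∈ σ '' M ∧ σ '' M ∉ G.blocks := by
    intro p pX pz
    by_cases pL : p ∈ L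
    · have ht : σ.symm p ∈ L ∧ σ.symm p ≠ z := by
        by_contra hn
        have := hfix _ hn
        rw [Equiv.apply_symm_apply] at this
        exact hn (this ▸ ⟨pL, pz⟩)
      have hne : σ.symm p ≠ w := fun e => wL (e ▸ ht.1)
      obtain ⟨M, hM, tM, wM⟩ := h.exists_block _ _ hne
      exact ⟨M, hM, h.subset_plane hM hne tM wM (hLX ht.1) wX, ⟨_, tM, by simp⟩,
        hnon M hM (fun e => wL (e ▸ wM)) _ tM ht.1 ht.2⟩
    · obtain ⟨t, tL, tz, -⟩ := h.exists_mem_ne_ne hL z z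
      have hne : p ≠ t := fun e => pL (e ▸ tL)
      obtain ⟨M, hM, pM, tM⟩ := h.exists_block _ _ hne
      exact ⟨M, hM, h.subset_plane hM hne pM tM pX (hLX tL),
        ⟨p, pM, hfix p fun hn => pL hn.1⟩, hnon M hM (fun e => pL (e ▸ pM)) t tM tL tz⟩
  refine ⟨σ, hX, z, fun p => ⟨fun hp => ?_, ?_⟩⟩
  · by_contra pz
    by_cases pX : p ∈ X
    · obtain ⟨M, hM, hMX, pM, hn⟩ := hX_notV p pX pz
      exact h.not_isVeblenPoint_twist_of_mem hX hM hMX pM hn hp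
    · obtain ⟨M, hM, hMX, -, hn⟩ := hX_notV w wX (fun e => wL (e ▸ zL))
      exact h.not_isVeblenPoint_twist_of_notMem hX pX hM hMX hn hp
  · rintro rfl
    refine h.isVeblenPoint_twist_of_mem hX (hLX zL) ?_
    rintro M hM - ⟨z', hz', e⟩
    obtain rfl := σ.injective (e.trans hz.symm)
    -- L is mapped onto itself, and every other line through z is fixed pointwise.
    by_cases hML : M = L
    · subst hML
      have : σ '' M ⊆ M := by
        rintro _ ⟨m, hm, rfl⟩
        by_cases hmz : m = z'
        · rwa [hmz, hz]
        · exact (hmov m hm hmz).1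
      rwa [Set.eq_of_subset_of_ncard_le this (Set.ncard_image_of_injective _ σ.injective).ge]
    · have : σ '' M = id '' M := Set.image_congr fun m mM => hfix m fun hn =>
        hML (h.block_unique hM hL hn.2 mM hz' hn.1 zL)
      rwa [this, Set.image_id]

/-- Permuting a triangle of `X` cyclically leaves no Veblen point. -/
theorem exists_twist_no_isVeblenPoint (h : G.IsSpaceWithPlane X q) :
    ∃ σ : Equiv.Perm P, (∀ x, σ x ∈ X ↔ x ∈ X) ∧ ∀ p, ¬ (G.twist X σ).IsVeblenPoint p := by
  classical
  obtain ⟨L, hL, hLX⟩ := h.exists_subset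
  obtain ⟨w, wX, wL⟩ := h.exists_notMem_block L hL
  obtain ⟨x, xL, -, -⟩ := h.exists_mem_ne_ne hL w w
  obtain ⟨y, yL, hyx, -⟩ := h.exists_mem_ne_ne hL x x
  have hxw : x ≠ w := fun e => wL (e ▸ xL)
  have hyw : y ≠ w := fun e => wL (e ▸ yL)
  have xX := hLX xL
  have yX := hLX yL
  let σ : Equiv.Perm P := Equiv.swap x y * Equiv.swap y w
  have σx : σ x = y := by
    simp only [σ, Equiv.Perm.mul_apply]
    rw [Equiv.swap_apply_of_ne_of_ne hyx.symm hxw, Equiv.swap_apply_left]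
  have σy : σ y = w := by
    simp only [σ, Equiv.Perm.mul_apply]
    rw [Equiv.swap_apply_left, Equiv.swap_apply_of_ne_of_ne hxw.symm hyw.symm]
  have σw : σ w = x := by
    simp only [σ, Equiv.Perm.mul_apply]
    rw [Equiv.swap_apply_right, Equiv.swap_apply_right]
  have hfix : ∀ p, p ≠ x → p ≠ y → p ≠ w → σ p = p := fun p px py pw => by
    simp only [σ, Equiv.Perm.mul_apply]
    rw [Equiv.swap_apply_of_ne_of_ne py pw, Equiv.swap_apply_of_ne_of_ne px py]
  have hX : ∀ p, σ p ∈ X ↔ p ∈ X := fun p => by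
    by_cases px : p = x
    · rw [px, σx]; exact iff_of_true yX xX
    by_cases py : p = y
    · rw [py, σy]; exact iff_of_true wX yX
    by_cases pw : p = w
    · rw [pw, σw]; exact iff_of_true xX wX
    rw [hfix p px py pw]
  have hside : ∀ M ∈ G.blocks, x ∈ M → y ∈ M → w ∉ M := fun M hM xM yM wM =>
    wL (h.block_unique hM hL hyx yM xM yL xL ▸ wM)
  have hxy : ∀ M ∈ G.blocks, x ∈ M → y ∈ M → σ '' M ∉ G.blocks := fun M hM xM yM =>
    h.image_notMem_blocks_of_pair hM xM yM (hside M hM xM yM) σx σy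
      fun m mM mx my => hfix m mx my fun e => hside M hM xM yM (e ▸ mM)
  have hyw' : ∀ M ∈ G.blocks, y ∈ M → w ∈ M → σ '' M ∉ G.blocks := fun M hM yM wM =>
    h.image_notMem_blocks_of_pair hM yM wM (fun xM => hside M hM xM yM wM) σy σw
      fun m mM my mw => hfix m (fun e => hside M hM (e ▸ mM) yM wM) my mw
  have hwx : ∀ M ∈ G.blocks, w ∈ M → x ∈ M → σ '' M ∉ G.blocks := fun M hM wM xM =>
    h.image_notMem_blocks_of_pair hM wM xM (fun yM => hside M hM xM yM wM) σw σx
      fun m mM mw mx => hfix m mx (fun e => hside M hM xM (e ▸ mM) wM) mw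
  refine ⟨σ, hX, fun p => ?_⟩
  by_cases pX : p ∈ X
  swap
  · exact h.not_isVeblenPoint_twist_of_notMem hX pX hL hLX (hxy L hL xL yL)
  by_cases px : p = x
  · obtain ⟨M, hM, xM, wM⟩ := h.exists_block _ _ hxw
    exact h.not_isVeblenPoint_twist_of_mem hX hM (h.subset_plane hM hxw xM wM xX wX)
      ⟨w, wM, σw.trans px.symm⟩ (hwx M hM wM xM)
  by_cases py : p = y
  · exact h.not_isVeblenPoint_twist_of_mem hX hL hLX ⟨x, xL, σx.trans py.symm⟩ (hxy L hL xL yL)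
  by_cases pw : p = w
  · obtain ⟨M, hM, yM, wM⟩ := h.exists_block _ _ hyw
    exact h.not_isVeblenPoint_twist_of_mem hX hM (h.subset_plane hM hyw yM wM yX wX)
      ⟨y, yM, σy.trans pw.symm⟩ (hyw' M hM yM wM)
  obtain ⟨M, hM, pM, xM⟩ := h.exists_block _ _ px
  refine h.not_isVeblenPoint_twist_of_mem hX hM (h.subset_plane hM px pM xM pX xX)
    ⟨p, pM, hfix p px py pw⟩ ?_
  -- The line from p to x is either a side of the triangle or has x as its only moved point.
  by_cases yM : y ∈ M
  · exact hxy M hM xM yM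
  by_cases wM : w ∈ M
  · exact hwx M hM wM xM
  · exact h.image_notMem_blocks_of_fix hM xM
      (fun m mM mx => hfix m mx (fun e => yM (e ▸ mM)) (fun e => wM (e ▸ mM))) (by rwa [σx])

/-! ### Fixed points of automorphisms -/

/-- An automorphism leaving invariant `X` and a block in `X` has a fixed point. -/
theorem exists_fixed_of_image_eq (h : G.IsSpaceWithPlane X q) (hσ : ∀ x, σ x ∈ X ↔ x ∈ X)
    {g : Equiv.Perm P} (hg : (G.twist X σ).IsIsomorphism (G.twist X σ) g)
    (gX : ∀ p, g p ∈ X ↔ p ∈ X) {L : Set P} (hL : L ∈ (G.twist X σ).blocks) (hLX : L ⊆ X)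
    (hgL : g '' L = L) : ∃ p, g p = p := by
  classical
  by_contra! hn
  let 𝓛 := {B : Set P // B ∈ (G.twist X σ).blocks ∧ B ⊆ X}
  let : Membership X 𝓛 := ⟨fun B p => (p : P) ∈ B.1⟩
  have hline : ∀ p r : X, p ≠ r → ∃ B : 𝓛, p ∈ B ∧ r ∈ B := by
    intro p r hpr
    have hne : (p : P) ≠ r := fun e => hpr (Subtype.ext e)
    obtain ⟨B, hB, pB, rB⟩ := h.twist_exists_block hσ hne
    exact ⟨⟨B, hB, h.twist_subset_plane hσ hB hne pB rB p.2 r.2⟩, pB, rB⟩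
  have huniq : ∀ {p r : X} {B C : 𝓛}, p ∈ B → r ∈ B → p ∈ C → r ∈ C → p = r ∨ B = C := by
    intro p r B C pB rB pC rC
    by_cases hpr : p = r
    · exact Or.inl hpr
    · exact Or.inr (Subtype.ext (h.twist_block_unique hσ B.2.1 C.2.1
        (fun e => hpr (Subtype.ext e)) pB rB pC rC))
  have hpoint : ∀ B : 𝓛, ∃ p : X, p ∉ B := by
    rintro ⟨B, hB, hBX⟩
    obtain ⟨M, hM, -, rfl⟩ := (mem_twist_of_subset hBX).1 hB
    obtain ⟨w, wX, wM⟩ := h.exists_notMem_block M hM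
    exact ⟨⟨σ w, (hσ w).2 wX⟩, fun hm => wM ((σ.injective.mem_set_image).1 hm)⟩
  have hncard : 1 < L.ncard := by
    have := h.ncard_twist hL
    have := h.two_le
    omega
  -- For p on L, a line joining a point off L to another point of L avoids p.
  have hexl : ∀ p : X, ∃ B : 𝓛, p ∉ B := by
    intro p
    by_cases pL : (p : P) ∈ L
    · obtain ⟨w, hw⟩ := hpoint ⟨L, hL, hLX⟩
      obtain ⟨u, uL, up⟩ := Set.exists_ne_of_one_lt_ncard hncard (p : P)
      obtain ⟨B, wB, uB⟩ := hline w ⟨u, hLX uL⟩ (fun e => hw (e ▸ uL))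
      refine ⟨B, fun pB => ?_⟩
      rcases huniq (C := ⟨L, hL, hLX⟩) uB pB uL pL with e | e
      · exact up (congrArg Subtype.val e)
      · exact hw (e ▸ wB)
    · exact ⟨⟨L, hL, hLX⟩, pL⟩
  let : Configuration.HasLines X 𝓛 :=
    { exists_point := hpoint
      exists_line := hexl
      eq_or_eq := huniq
      mkLine := fun {p r} hpr => Classical.choose (hline p r hpr)
      mkLine_ax := fun {p r} hpr => Classical.choose_spec (hline p r hpr) }
  let : Fintype X := Fintype.ofFinite _
  let : Fintype 𝓛 := Fintype.ofFinite _
  have hcard := Configuration.HasLines.card_le X 𝓛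
  have hne : ∀ p : X, p ≠ ⟨g p, (gX p).2 p.2⟩ := fun p e => hn p (congrArg Subtype.val e).symm
  -- Without fixed points, p ↦ the block joining p and g p is a map from points to blocks of the
  -- plane.
  choose f hf₁ hf₂ using fun p : X => hline p _ (hne p)
  have hfeq : ∀ (p : X) (B : 𝓛), (p : P) ∈ B.1 → g p ∈ B.1 → f p = B := fun p B h₁ h₂ =>
    (huniq (hf₁ p) (hf₂ p) h₁ h₂).resolve_left (hne p)
  -- B meets its preimage under g in a point p; then p and g p both lie on B.
  have hsurj : Function.Surjective f := by
    intro B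
    have hB' : g.symm '' B.1 ∈ (G.twist X σ).blocks := by
      rw [← hg, Equiv.image_symm_image]
      exact B.2.1
    have hBX' : g.symm '' B.1 ⊆ X := by
      rintro _ ⟨b, hb, rfl⟩
      rw [← gX, Equiv.apply_symm_apply]
      exact B.2.2 hb
    obtain ⟨p, pB, b, hb, e⟩ := h.twist_meet B.2.1 hB' B.2.2 hBX'
    exact ⟨⟨p, B.2.2 pB⟩, hfeq _ B pB (by simpa [← e] using hb)⟩
  -- A plane has at most as many points as blocks, so the surjection f is a bijection. Yet f sends
  -- every point of the invariant block L to L.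
  have hinj : Function.Injective f :=
    ((Fintype.bijective_iff_surjective_and_card f).2
      ⟨hsurj, hcard.antisymm (Fintype.card_le_of_surjective f hsurj)⟩).1
  obtain ⟨u, uL, v, vL, huv⟩ := Set.one_lt_ncard_iff_nontrivial.1 hncard
  have hfL : ∀ (u : P) (uL : u ∈ L), f ⟨u, hLX uL⟩ = ⟨L, hL, hLX⟩ := fun u uL =>
    hfeq _ _ uL (by
      have := Set.mem_image_of_mem g uL
      rwa [hgL] at this)
  exact huv (congrArg Subtype.val (hinj ((hfL u uL).trans (hfL v vL).symm)))

/-! ### Transpositions -/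

section Swap

open Classical in
theorem swap_mem_iff {x y : P} (xX : x ∈ X) (yX : y ∈ X) (p : P) :
    Equiv.swap x y p ∈ X ↔ p ∈ X := by
  by_cases px : p = x
  · simp [px, xX, yX]
  by_cases py : p = y
  · simp [py, xX, yX]
  rw [Equiv.swap_apply_of_ne_of_ne px py]

open Classical in
theorem image_swap_notMem_blocks (h : G.IsSpaceWithPlane X q) {x y : P} {M : Set P}
    (hM : M ∈ G.blocks) (xM : x ∈ M) (yM : y ∉ M) : Equiv.swap x y '' M ∉ G.blocks :=
  h.image_notMem_blocks_of_fix hM xM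
    (fun _ mM mx => Equiv.swap_apply_of_ne_of_ne mx fun e => yM (e ▸ mM))
    (by rwa [Equiv.swap_apply_left])

open Classical in
theorem image_swap_image_swap (x y : P) (M : Set P) :
    Equiv.swap x y '' (Equiv.swap x y '' M) = M := by
  rw [Set.image_image]
  simp

open Classical in
theorem image_swap_eq_of_mem {x y : P} {M : Set P} (xM : x ∈ M) (yM : y ∈ M) :
    Equiv.swap x y '' M = M := by
  rw [Equiv.image_eq_preimage_symm]
  ext p
  exact swap_mem_iff xM yM p

open Classical in
-- A line other than L through x or y contains just one of them, so its image is not a line; lines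
-- missing both, and L itself, are kept. Each point of X off L lies on the image of a changed line,
-- as do x and y.
theorem isVeblenPoint_twist_swap_iff (h : G.IsSpaceWithPlane X q) {x y : P} {L : Set P}
    (hL : L ∈ G.blocks) (hxy : x ≠ y) (xL : x ∈ L) (yL : y ∈ L) (hLX : L ⊆ X) (p : P) :
    (G.twist X (Equiv.swap x y)).IsVeblenPoint p ↔ p ∈ L ∧ p ≠ x ∧ p ≠ y := by
  have hX := swap_mem_iff (hLX xL) (hLX yL)
  have hx : ∀ M ∈ G.blocks, x ∈ M → M ≠ L → Equiv.swap x y '' M ∉ G.blocks :=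
    fun M hM xM hML => h.image_swap_notMem_blocks hM xM
      fun yM => hML (h.block_unique hM hL hxy xM yM xL yL)
  have hy : ∀ M ∈ G.blocks, y ∈ M → M ≠ L → Equiv.swap x y '' M ∉ G.blocks := by
    intro M hM yM hML
    rw [Equiv.swap_comm]
    exact h.image_swap_notMem_blocks hM yM
      fun xM => hML (h.block_unique hM hL hxy xM yM xL yL)
  obtain ⟨w, wX, wL⟩ := h.exists_notMem_block L hL
  have through : ∀ u ∈ L, ∃ M ∈ G.blocks, M ⊆ X ∧ u ∈ M ∧ M ≠ L := by
    intro u uL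
    have hne : u ≠ w := fun e => wL (e ▸ uL)
    obtain ⟨M, hM, uM, wM⟩ := h.exists_block _ _ hne
    exact ⟨M, hM, h.subset_plane hM hne uM wM (hLX uL) wX, uM, fun e => wL (e ▸ wM)⟩
  constructor
  · intro hp
    by_contra hn
    by_cases pX : p ∈ X
    swap
    · obtain ⟨M, hM, hMX, xM, hML⟩ := through x xL
      exact h.not_isVeblenPoint_twist_of_notMem hX pX hM hMX (hx M hM xM hML) hp
    by_cases px : p = x
    · obtain ⟨M, hM, hMX, yM, hML⟩ := through y yL
      exact h.not_isVeblenPoint_twist_of_mem hX hM hMX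
        ⟨y, yM, by rw [px, Equiv.swap_apply_right]⟩ (hy M hM yM hML) hp
    by_cases py : p = y
    · obtain ⟨M, hM, hMX, xM, hML⟩ := through x xL
      exact h.not_isVeblenPoint_twist_of_mem hX hM hMX
        ⟨x, xM, by rw [py, Equiv.swap_apply_left]⟩ (hx M hM xM hML) hp
    have pL : p ∉ L := fun pL => hn ⟨pL, px, py⟩
    obtain ⟨M, hM, pM, xM⟩ := h.exists_block _ _ px
    exact h.not_isVeblenPoint_twist_of_mem hX hM (h.subset_plane hM px pM xM pX (hLX xL))
      ⟨p, pM, Equiv.swap_apply_of_ne_of_ne px py⟩ (hx M hM xM fun e => pL (e ▸ pM)) hp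
  · rintro ⟨pL, px, py⟩
    refine h.isVeblenPoint_twist_of_mem hX (hLX pL) ?_
    rintro M hM - ⟨p', hp', e⟩
    have : p' = p := by
      rw [Equiv.swap_apply_eq_iff, Equiv.swap_apply_of_ne_of_ne px py] at e
      exact e
    subst this
    by_cases hML : M = L
    · rw [hML, image_swap_eq_of_mem xL yL]
      exact hL
    · have : Equiv.swap x y '' M = id '' M := Set.image_congr fun m mM =>
        Equiv.swap_apply_of_ne_of_ne
          (fun e => hML (h.block_unique hM hL px hp' (e ▸ mM) pL xL))
          (fun e => hML (h.block_unique hM hL py hp' (e ▸ mM) pL yL))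
      rwa [this, Set.image_id]

open Classical in
theorem hasDefectTriangle_twist_swap_iff (h : G.IsSpaceWithPlane X q) {x y : P} (hxy : x ≠ y)
    (xX : x ∈ X) (yX : y ∈ X) (p : P) :
    (G.twist X (Equiv.swap x y)).HasDefectTriangle p ↔ p ∉ X := by
  have hX := swap_mem_iff xX yX
  refine ⟨fun hp pX => h.not_hasDefectTriangle_of_mem hX pX hp, fun pX => ?_⟩
  obtain ⟨L, hL, xL, yL⟩ := h.exists_block _ _ hxy
  have hx : ∀ M ∈ G.blocks, x ∈ M → y ∉ M → M ⊆ X →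
      M ∉ (G.twist X (Equiv.swap x y)).blocks := by
    intro M hM xM yM hMX hM'
    obtain ⟨N, hN, -, e⟩ := (mem_twist_of_subset hMX).1 hM'
    refine h.image_swap_notMem_blocks hM xM yM ?_
    have : Equiv.swap x y '' M = N := by
      rw [e, image_swap_image_swap]
    rwa [this]
  have hy : ∀ M ∈ G.blocks, y ∈ M → x ∉ M → M ⊆ X →
      M ∉ (G.twist X (Equiv.swap x y)).blocks := by
    intro M hM yM xM hMX hM'
    obtain ⟨N, hN, -, e⟩ := (mem_twist_of_subset hMX).1 hM'
    rw [Equiv.swap_comm] at e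
    refine h.image_swap_notMem_blocks hM yM xM ?_
    have : Equiv.swap y x '' M = N := by
      rw [e, image_swap_image_swap]
    rwa [this]
  obtain ⟨w, wX, wL⟩ := h.exists_notMem_block L hL
  have hyw : y ≠ w := fun e => wL (e ▸ yL)
  have hxw : x ≠ w := fun e => wL (e ▸ xL)
  obtain ⟨M, hM, yM, wM⟩ := h.exists_block _ _ hyw
  have hMX := h.subset_plane hM hyw yM wM yX wX
  have xM : x ∉ M := fun xM => wL (h.block_unique hM hL hxy xM yM xL yL ▸ wM)
  obtain ⟨b, bM, by', bw⟩ := h.exists_mem_ne_ne hM y w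
  have bL : b ∉ L := fun bL => wL (h.block_unique hM hL by' bM yM bL yL ▸ wM)
  have key : ∀ c ∈ X, c ∉ L → ∀ N ∈ G.blocks, c ∈ N → x ∈ N →
      N ∉ (G.twist X (Equiv.swap x y)).blocks := by
    intro c cX cL N hN cN xN
    have hcx : c ≠ x := fun e => cL (e ▸ xL)
    exact hx N hN xN (fun yN => cL (h.block_unique hN hL hxy xN yN xL yL ▸ cN))
      (h.subset_plane hN hcx cN xN cX xX)
  -- The points w, b, x serve: the line wb passes through y but not x, while wx and bx pass through
  -- x but not y, so none of them is a twisted block.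
  refine h.hasDefectTriangle_of_notMem hX pX wX (hMX bM) xX bw.symm hxw.symm
    (fun e => bL (e ▸ xL)) ?_ (key w wX wL) (key b (hMX bM) bL)
  intro N hN wN bN
  rw [h.block_unique hN hM bw bN wN bM wM]
  exact hy M hM yM xM hMX

/-- The source of the condition q > 2: a fourth point on the line xy is the second Veblen point. -/
theorem exists_mem_ne_ne_ne (h : G.IsSpaceWithPlane X q) (hq : 2 < q) {L : Set P}
    (hL : L ∈ G.blocks) (a b c : P) : ∃ d ∈ L, d ≠ a ∧ d ≠ b ∧ d ≠ c := by
  have h3 : ({a, b, c} : Set P).ncard < L.ncard := by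
    have h₁ := Set.ncard_insert_le a {b, c}
    have h₂ := Set.ncard_insert_le b {c}
    have h₃ := Set.ncard_singleton c
    have := h.ncard_block L hL
    omega
  obtain ⟨d, hd, hn⟩ := Set.exists_mem_notMem_of_ncard_lt_ncard h3
  exact ⟨d, hd, fun e => hn (by simp [e]), fun e => hn (by simp [e]), fun e => hn (by simp [e])⟩

open Classical in
theorem exists_isVeblenPoint_ne_twist_swap (h : G.IsSpaceWithPlane X q) (hq : 2 < q) {x y : P}
    (hxy : x ≠ y) (xX : x ∈ X) (yX : y ∈ X) :
    ∃ z₁ z₂, z₁ ≠ z₂ ∧ (G.twist X (Equiv.swap x y)).IsVeblenPoint z₁ ∧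
      (G.twist X (Equiv.swap x y)).IsVeblenPoint z₂ := by
  obtain ⟨L, hL, xL, yL⟩ := h.exists_block _ _ hxy
  have hLX := h.subset_plane hL hxy xL yL xX yX
  obtain ⟨z₁, hz₁, hz₁x, hz₁y⟩ := h.exists_mem_ne_ne hL x y
  obtain ⟨z₂, hz₂, hz₂x, hz₂y, hz₁₂⟩ := h.exists_mem_ne_ne_ne hq hL x y z₁
  have hV := h.isVeblenPoint_twist_swap_iff hL hxy xL yL hLX
  exact ⟨z₁, z₂, hz₁₂.symm, (hV z₁).2 ⟨hz₁, hz₁x, hz₁y⟩, (hV z₂).2 ⟨hz₂, hz₂x, hz₂y⟩⟩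

open Classical in
theorem exists_not_isVeblenPoint_twist_swap (h : G.IsSpaceWithPlane X q) {x y : P}
    (hxy : x ≠ y) (xX : x ∈ X) (yX : y ∈ X) :
    ∃ p, ¬ (G.twist X (Equiv.swap x y)).IsVeblenPoint p := by
  obtain ⟨L, hL, xL, yL⟩ := h.exists_block _ _ hxy
  refine ⟨x, fun hx => ?_⟩
  exact ((h.isVeblenPoint_twist_swap_iff hL hxy xL yL
    (h.subset_plane hL hxy xL yL xX yX) x).1 hx).2.1 rfl

open Classical in
theorem exists_fixed_twist_swap (h : G.IsSpaceWithPlane X q) (hq : 2 < q) {x y : P}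
    (hxy : x ≠ y) (xX : x ∈ X) (yX : y ∈ X) {g : Equiv.Perm P}
    (hg : g ∈ (G.twist X (Equiv.swap x y)).autGroup) : ∃ p, g p = p := by
  change (G.twist X (Equiv.swap x y)).IsIsomorphism _ g at hg
  have hX := swap_mem_iff xX yX
  obtain ⟨L, hL, xL, yL⟩ := h.exists_block _ _ hxy
  have hLX := h.subset_plane hL hxy xL yL xX yX
  have hV := h.isVeblenPoint_twist_swap_iff hL hxy xL yL hLX
  have hL' : L ∈ (G.twist X (Equiv.swap x y)).blocks :=
    Or.inr ⟨L, hL, hLX, (image_swap_eq_of_mem xL yL).symm⟩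
  -- Defect triangles characterise the complement of X, so X is invariant.
  have gX : ∀ p, g p ∈ X ↔ p ∈ X := by
    intro p
    rw [← not_iff_not, ← h.hasDefectTriangle_twist_swap_iff hxy xX yX,
      ← h.hasDefectTriangle_twist_swap_iff hxy xX yX]
    exact ⟨fun hp => by simpa using hp.apply hg.symm, fun hp => hp.apply hg⟩
  obtain ⟨z₁, z₂, hz, hz₁, hz₂⟩ := h.exists_isVeblenPoint_ne_twist_swap hq hxy xX yX
  refine h.exists_fixed_of_image_eq hX hg gX hL' hLX ?_
  -- L and its image share the images of two Veblen points, which are again Veblen points and so lie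
  -- on L.
  exact h.twist_block_unique hX ((hg L).2 hL') hL' (g.injective.ne hz)
    (Set.mem_image_of_mem g ((hV z₁).1 hz₁).1) (Set.mem_image_of_mem g ((hV z₂).1 hz₂).1)
    ((hV _).1 (hz₁.apply hg)).1 ((hV _).1 (hz₂.apply hg)).1

end Swap

end IsSpaceWithPlane

end BlockGeometry

namespace ProjectiveDesign

open Module

/-! ### The axioms for PG(V) with a plane -/

section Points

variable {K V : Type*} [Field K] [AddCommGroup V] [Module K V]

theorem mem_points {W : Submodule K V} {p : Projectivization K V} :
    p ∈ points K W ↔ p.submodule ≤ W := Iff.rfl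

theorem mk_mem_points {W : Submodule K V} {v : V} (hv : v ≠ 0) :
    Projectivization.mk K v hv ∈ points K W ↔ v ∈ W := by
  rw [mem_points, Projectivization.submodule_mk, Submodule.span_singleton_le_iff_mem]

theorem points_subset_points {W U : Submodule K V} : points K W ⊆ points K U ↔ W ≤ U := by
  refine ⟨fun h v hv => ?_, fun h _ hp => le_trans hp h⟩
  by_cases h0 : v = 0
  · simp [h0]
  · exact (mk_mem_points h0).1 (h ((mk_mem_points h0).2 hv))

theorem exists_mem_points_notMem {W U : Submodule K V} (h : ¬ U ≤ W) :
    ∃ p ∈ points K U, p ∉ points K W := by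
  rw [← points_subset_points] at h
  exact Set.not_subset.1 h

theorem points_eq_range_map (W : Submodule K V) :
    points K W = Set.range (Projectivization.map W.subtype W.injective_subtype) := by
  ext p
  induction p with | h v hv =>
  rw [mk_mem_points]
  constructor
  · intro hvW
    exact ⟨Projectivization.mk K ⟨v, hvW⟩ fun e => hv (congrArg Subtype.val e), rfl⟩
  · rintro ⟨r, hr⟩
    induction r with | h w hw =>
    rw [Projectivization.map_mk] at hr
    rw [← mk_mem_points hv, ← hr, mk_mem_points]
    exact w.2

theorem ncard_points [Finite K] (W : Submodule K V) (hW : finrank K W = 2) :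
    (points K W).ncard = Nat.card K + 1 := by
  rw [points_eq_range_map, ← Set.image_univ,
    Set.ncard_image_of_injective _ (Projectivization.map_injective (τ := RingHom.id K) _ _),
    Set.ncard_univ,
    Projectivization.card_of_finrank_two K W hW]

theorem finrank_sup_of_ne {p r : Projectivization K V} (h : p ≠ r) :
    finrank K ↥(p.submodule ⊔ r.submodule) = 2 := by
  have h₁ := Submodule.finrank_sup_add_finrank_inf_eq p.submodule r.submodule
  rw [p.finrank_submodule, r.finrank_submodule] at h₁
  have h₂ : finrank K ↥(p.submodule ⊓ r.submodule) ≠ 1 := fun e => by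
    have e₁ := Submodule.eq_of_le_of_finrank_eq (inf_le_left : p.submodule ⊓ r.submodule ≤ _)
      (e.trans p.finrank_submodule.symm)
    have e₂ := Submodule.eq_of_le_of_finrank_eq (inf_le_right : p.submodule ⊓ r.submodule ≤ _)
      (e.trans r.finrank_submodule.symm)
    exact h (Projectivization.submodule_injective (e₁.symm.trans e₂))
  have h₃ := Submodule.finrank_mono (inf_le_left : p.submodule ⊓ r.submodule ≤ _)
  rw [p.finrank_submodule] at h₃
  omega

variable [FiniteDimensional K V]

theorem sup_eq_of_mem_points {p r : Projectivization K V} (h : p ≠ r) {W : Submodule K V}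
    (hW : finrank K W = 2) (hp : p ∈ points K W) (hr : r ∈ points K W) :
    p.submodule ⊔ r.submodule = W :=
  Submodule.eq_of_le_of_finrank_eq (sup_le hp hr) ((finrank_sup_of_ne h).trans hW.symm)

theorem points_inter_nonempty {W W' U : Submodule K V} (hW : W ≤ U) (hW' : W' ≤ U)
    (h : finrank K U < finrank K W + finrank K W') : (points K W ∩ points K W').Nonempty := by
  have h₁ := Submodule.finrank_sup_add_finrank_inf_eq W W'
  have h₂ := Submodule.finrank_mono (sup_le hW hW')
  have h₃ : W ⊓ W' ≠ ⊥ := fun e => by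
    rw [e, finrank_bot] at h₁
    omega
  obtain ⟨v, hv, hv0⟩ := Submodule.exists_mem_ne_zero_of_ne_bot h₃
  exact ⟨Projectivization.mk K v hv0, (mk_mem_points hv0).2 hv.1, (mk_mem_points hv0).2 hv.2⟩

theorem not_le_of_finrank_lt {W U : Submodule K V} (h : finrank K W < finrank K U) : ¬ U ≤ W :=
  fun hs => absurd (Submodule.finrank_mono hs) (not_le.2 h)

theorem isSpaceWithPlane_PG [Finite K] (U : Submodule K V) (hU : finrank K U = 3)
    (hV : 3 < finrank K V) :
    (PG K V).IsSpaceWithPlane (points K U) (Nat.card K) where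
  two_le := Finite.one_lt_card
  exists_block x y hxy :=
    ⟨_, ⟨_, finrank_sup_of_ne hxy, rfl⟩, mem_points.2 le_sup_left, mem_points.2 le_sup_right⟩
  block_unique := by
    rintro _ _ x y ⟨W, hW, rfl⟩ ⟨W', hW', rfl⟩ hxy h₁ h₂ h₃ h₄
    rw [← sup_eq_of_mem_points hxy hW h₁ h₂, ← sup_eq_of_mem_points hxy hW' h₃ h₄]
  isVeblenPoint := by
    rintro p _ ⟨W, hW, rfl⟩ _ ⟨W', hW', rfl⟩ pW pW' hWW'
    have key : ∀ a ∈ points K W, ∀ b ∈ points K W', a ≠ p → ∀ T : Submodule K V,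
        finrank K T = 2 → a ∈ points K T → b ∈ points K T → T ≤ W ⊔ W' := by
      intro a ha b hb hap T hT aT bT
      have hab : a ≠ b := by
        rintro rfl
        apply hWW'
        rw [← sup_eq_of_mem_points hap hW ha pW, ← sup_eq_of_mem_points hap hW' hb pW']
      rw [← sup_eq_of_mem_points hab hT aT bT]
      exact sup_le_sup ha hb
    rintro a₁ ha₁ a₂ ha₂ b₁ hb₁ b₂ hb₂ na₁ na₂ - - _ ⟨T, hT, rfl⟩ _ ⟨T', hT', rfl⟩ h₁ h₂ h₃ h₄
    -- Two lines through p span a subspace of dimension at most 2 + 2 - 1 = 3, in which two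
    -- 2-dimensional subspaces intersect nontrivially.
    refine points_inter_nonempty (key a₁ ha₁ b₁ hb₁ na₁ T hT h₁ h₂)
      (key a₂ ha₂ b₂ hb₂ na₂ T' hT' h₃ h₄) ?_
    have e₁ := Submodule.finrank_sup_add_finrank_inf_eq W W'
    have e₂ := Submodule.finrank_mono (le_inf pW pW' : p.submodule ≤ W ⊓ W')
    rw [p.finrank_submodule] at e₂
    omega
  ncard_block := by
    rintro _ ⟨W, hW, rfl⟩
    exact ncard_points W hW
  subset_plane := by
    rintro _ x y ⟨W, hW, rfl⟩ hxy xW yW xU yU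
    rw [points_subset_points, ← sup_eq_of_mem_points hxy hW xW yW]
    exact sup_le xU yU
  meet := by
    rintro _ _ ⟨W, hW, rfl⟩ ⟨W', hW', rfl⟩ hWU hWU'
    exact points_inter_nonempty (points_subset_points.1 hWU) (points_subset_points.1 hWU')
      (by omega)
  exists_notMem_block := by
    rintro _ ⟨W, hW, rfl⟩
    exact exists_mem_points_notMem (not_le_of_finrank_lt (by omega))
  exists_notMem := by
    obtain ⟨p, -, hp⟩ := exists_mem_points_notMem (U := (⊤ : Submodule K V)) (W := U)
      (not_le_of_finrank_lt (by rw [finrank_top]; omega))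
    exact ⟨p, hp⟩
  exists_subset := by
    obtain ⟨p, pU, -⟩ := exists_mem_points_notMem (U := U) (W := ⊥)
      (not_le_of_finrank_lt (by rw [finrank_bot]; omega))
    obtain ⟨r, rU, hr⟩ := exists_mem_points_notMem (U := U) (W := p.submodule)
      (not_le_of_finrank_lt (by rw [p.finrank_submodule]; omega))
    have hpr : p ≠ r := fun e => hr (e ▸ mem_points.2 le_rfl)
    exact ⟨_, ⟨_, finrank_sup_of_ne hpr, rfl⟩, points_subset_points.2 (sup_le pU rU)⟩

end Points

/-! ### From `twisted` to `twist` -/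

section Twisted

variable {K V : Type*} [Field K] [AddCommGroup V] [Module K V]

open Classical in
-- Extends the transposition of X to the whole point set, the form that `twist` expects.
theorem IsTransposition.exists_eq_swap {α : Type*} {X : Set α} {π : Equiv.Perm X}
    (hπ : IsTransposition π) :
    ∃ a ∈ X, ∃ b ∈ X, a ≠ b ∧ ∀ x, (π x : α) = Equiv.swap a b x := by
  obtain ⟨a, b, hab, rfl⟩ := hπ
  refine ⟨a, a.2, b, b.2, fun e => hab (Subtype.ext e), fun x => ?_⟩
  simp only [Equiv.swap_apply_def, Subtype.ext_iff]
  split_ifs <;> rfl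

theorem twisted_eq_twist (W : Submodule K V) (π : Equiv.Perm (points K W))
    (σ : Equiv.Perm (Projectivization K V)) (hσ : ∀ x, (π x : Projectivization K V) = σ x) :
    twisted W π = (PG K V).twist (points K W) σ := by
  have key : ∀ L ⊆ points K W, permImage π L = σ '' L := by
    intro L hL
    ext p
    constructor
    · rintro ⟨x, hx, rfl⟩
      exact ⟨x, hx, (hσ x).symm⟩
    · rintro ⟨x, hx, rfl⟩
      exact ⟨⟨x, hL hx⟩, hx, hσ _⟩
  unfold twisted BlockGeometry.twist
  congr 2
  ext B
  refine exists_congr fun L => and_congr_right fun _ => and_congr_right fun hL => ?_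
  rw [key L hL]

theorem not_isomorphic_PG_of_not_isVeblenPoint {X : Set (Projectivization K V)} {q : ℕ}
    (h : (PG K V).IsSpaceWithPlane X q) {P : Type*} {D : BlockGeometry P}
    {p : P} (hp : ¬ D.IsVeblenPoint p) : ¬ D.Isomorphic (PG K V) := by
  rintro ⟨e, he⟩
  exact hp (BlockGeometry.IsVeblenPoint.of_apply he (h.isVeblenPoint _))

theorem exists_finrank_eq_three (K : Type*) [Field K] :
    ∃ U : Submodule K (Fin 4 → K), finrank K U = 3 := by
  refine ⟨LinearMap.ker (LinearMap.proj (R := K) (φ := fun _ : Fin 4 => K) 0), ?_⟩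
  have := LinearMap.finrank_range_add_finrank_ker
    (LinearMap.proj (R := K) (φ := fun _ : Fin 4 => K) 0)
  rw [LinearMap.range_eq_top.2 (LinearMap.proj_surjective 0), finrank_top, finrank_self,
    finrank_fin_fun] at this
  omega

end Twisted

end ProjectiveDesign

theorem proposition3p4 (q : ℕ) (K : Type*) [Field K] [Finite K] (hq : Nat.card K = q) :
    -- the parameters of `PG₁(3, q)`
    (ProjectiveDesign.PG K (Fin 4 → K)).IsTwoDesign (q ^ 3 + q ^ 2 + q + 1) (q + 1) 1 ∧
    -- two designs; the automorphism group of the first one fixes a point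
    (∃ D₁ D₂ : BlockGeometry (Projectivization K (Fin 4 → K)),
      D₁.IsTwoDesign (q ^ 3 + q ^ 2 + q + 1) (q + 1) 1 ∧
      D₂.IsTwoDesign (q ^ 3 + q ^ 2 + q + 1) (q + 1) 1 ∧
      ¬ D₁.Isomorphic D₂ ∧
      ¬ D₁.Isomorphic (ProjectiveDesign.PG K (Fin 4 → K)) ∧
      ¬ D₂.Isomorphic (ProjectiveDesign.PG K (Fin 4 → K)) ∧
      ∃ p, ∀ g ∈ D₁.autGroup, g p = p) ∧
    -- for `q > 2` one of the two can be any `D_π` with `π` a transposition of a plane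
    (2 < q →
      ∀ W : Submodule K (Fin 4 → K), Module.finrank K W = 3 →
      ∀ π : Equiv.Perm (ProjectiveDesign.points K W), ProjectiveDesign.IsTransposition π →
        (ProjectiveDesign.twisted W π).IsTwoDesign (q ^ 3 + q ^ 2 + q + 1) (q + 1) 1 ∧
        ¬ (ProjectiveDesign.twisted W π).Isomorphic (ProjectiveDesign.PG K (Fin 4 → K)) ∧
        (∀ g ∈ (ProjectiveDesign.twisted W π).autGroup, ∃ p, g p = p) ∧
        ∃ D₁ : BlockGeometry (Projectivization K (Fin 4 → K)),
          D₁.IsTwoDesign (q ^ 3 + q ^ 2 + q + 1) (q + 1) 1 ∧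
          ¬ D₁.Isomorphic (ProjectiveDesign.twisted W π) ∧
          ¬ D₁.Isomorphic (ProjectiveDesign.PG K (Fin 4 → K)) ∧
          ∃ p, ∀ g ∈ D₁.autGroup, g p = p) := by
  classical
  subst hq
  have hV : Module.finrank K (Fin 4 → K) = 4 := Module.finrank_fin_fun K
  have hcard : Nat.card K ^ 3 + Nat.card K ^ 2 + Nat.card K + 1 =
      Nat.card (Projectivization K (Fin 4 → K)) := by
    rw [Projectivization.card_of_finrank K _ hV]
    simp only [Finset.sum_range_succ, Finset.sum_range_zero]
    ring
  rw [hcard]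
  -- The first design lives on one fixed plane U, unrelated to the plane W of the last part: only
  -- numbers of Veblen points are compared.
  obtain ⟨U, hU⟩ := ProjectiveDesign.exists_finrank_eq_three K
  have h := ProjectiveDesign.isSpaceWithPlane_PG U hU (by omega)
  obtain ⟨σ₁, hσ₁, z, hz⟩ := h.exists_twist_unique_isVeblenPoint
  obtain ⟨σ₂, hσ₂, hn⟩ := h.exists_twist_no_isVeblenPoint
  have hfix : ∃ p, ∀ g ∈ ((ProjectiveDesign.PG K (Fin 4 → K)).twist
      (ProjectiveDesign.points K U) σ₁).autGroup, g p = p :=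
    ⟨z, fun g hg => (hz _).1 (((hz z).2 rfl).apply hg)⟩
  obtain ⟨z', hz'⟩ : ∃ z', z' ≠ z := by
    obtain ⟨L, hL, -⟩ := h.exists_subset
    obtain ⟨u, -, hu, -⟩ := h.exists_mem_ne_ne hL z z
    exact ⟨u, hu⟩
  have hPG₁ : ¬ ((ProjectiveDesign.PG K (Fin 4 → K)).twist
      (ProjectiveDesign.points K U) σ₁).Isomorphic (ProjectiveDesign.PG K (Fin 4 → K)) :=
    ProjectiveDesign.not_isomorphic_PG_of_not_isVeblenPoint h (p := z') fun e => hz' ((hz z').1 e)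
  refine ⟨?_, ⟨_, _, h.twist_isTwoDesign hσ₁, h.twist_isTwoDesign hσ₂, ?_, hPG₁,
    ProjectiveDesign.not_isomorphic_PG_of_not_isVeblenPoint h (hn z), hfix⟩, ?_⟩
  · refine ⟨inferInstance, rfl, h.ncard_block, fun x y hxy => ?_⟩
    obtain ⟨B, hB, xB, yB⟩ := h.exists_block x y hxy
    rw [Set.ncard_eq_one]
    refine ⟨B, Set.eq_singleton_iff_unique_mem.2 ⟨⟨hB, xB, yB⟩, ?_⟩⟩
    rintro C ⟨hC, xC, yC⟩
    exact h.block_unique hC hB hxy xC yC xB yB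
  · rintro ⟨e, he⟩
    exact hn _ (((hz z).2 rfl).apply he)
  · rintro hq W hW π hπ
    obtain ⟨a, ha, b, hb, hab, hπ⟩ := hπ.exists_eq_swap
    rw [ProjectiveDesign.twisted_eq_twist W π _ hπ]
    have h' := ProjectiveDesign.isSpaceWithPlane_PG W hW (by omega)
    obtain ⟨p, hp⟩ := h'.exists_not_isVeblenPoint_twist_swap hab ha hb
    refine ⟨h'.twist_isTwoDesign (BlockGeometry.IsSpaceWithPlane.swap_mem_iff ha hb),
      ProjectiveDesign.not_isomorphic_PG_of_not_isVeblenPoint h hp,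
      fun g hg => h'.exists_fixed_twist_swap hq hab ha hb hg,
      _, h.twist_isTwoDesign hσ₁, ?_, hPG₁, hfix⟩
    rintro ⟨e, he⟩
    obtain ⟨z₁, z₂, hne, hz₁, hz₂⟩ :=
      h'.exists_isVeblenPoint_ne_twist_swap hq hab ha hb
    -- Two Veblen points would both be carried to the only Veblen point z of the first design.
    have e₁ := (hz _).1 (hz₁.apply he.symm)
    have e₂ := (hz _).1 (hz₂.apply he.symm)
    exact hne (e.symm.injective (e₁.trans e₂.symm))
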